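/- Let $\Theta$ be a measurable space, $\mu$ a finite measure on $\Theta$, and write $\mathbb{E}_\mu[f]=\mu(\Theta)^{-1}\int f\,d\mu$ (read as $0$ if $\mu=0$). Let $B(\mu)$ be the set of $\sigma$-finite measures on $\Theta$ with the same null sets as $\mu$, taken up to positive constant factors, and $p_{\eta,\nu}=d\eta/d\nu$. Let $B^2(\mu)$ be the set of $\eta\in B(\mu)$ with $\log p_{\eta,\mu}\in L^2(\mu)$, put $\Psi_\mu(\eta)=\log p_{\eta,\mu}-\mathbb{E}_\mu[\log p_{\eta,\mu}]$, and $\|\eta-\nu\|_{B^2(\mu)}=\|\Psi_\mu(\eta)-\Psi_\mu(\nu)\|_{L^2(\mu)}$ for $\eta,\nu\in B^2(\mu)$. Let $\mathcal{X}$ be a metric space with its Borel $\sigma$-algebra, and let $l$ be a likelihood, written $l_x(\theta)$ for $x\in\mathcal{X}$, $\theta\in\Theta$, such that $\phi_\mu\colon\mathcal{X}\to L^2(\mu)$, $\phi_\mu(x)=\log l_x-\mathbb{E}_\mu[\log l_x]$, is well defined (in particular $l_x>0$ $\mu$-almost everywhere and $\log l_x$ is $\mu$-integrable for every $x$) and measurable.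 Let $x_1,\dots,x_N\in\mathcal{X}$, let $\pi_0\in B^2(\mu)$ be the prior, and let $\pi\in B^2(\mu)$ be the posterior, so that $p_{\pi,\pi_0}$ equals $\prod_{n=1}^N l_{x_n}$ up to a positive constant factor, $\pi_0$-almost everywhere. Let $1\le M\le N$, let $(i_1,\dots,i_M)$ be drawn uniformly without replacement from $\{1,\dots,N\}$ and $z_m=x_{i_m}$. Let $\pi_M\in B(\mu)$ be the (random) approximate posterior for which $p_{\pi_M,\pi_0}$ equals $\bigl(\prod_{m=1}^M l_{z_m}\bigr)^{N/M}$ up to a positive constant factor, $\pi_0$-almost everywhere. Assume that $\|\phi_\mu(x_n)\|_{L^2(\mu)}\le\gamma$ for all $1\le n\le N$, and let $0<\delta<1$. Then $\pi_M\in B^2(\mu)$ always, and with probability at least $1-\delta$ $$\|\pi-\pi_M\|_{B^2(\mu)}\le\sqrt{\frac{8\gamma^2N(N-M+1)}{M}}\,\sqrt{2\log\left(\frac{2}{\delta}\right)}.$$ -/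

import Mathlib

open MeasureTheory

noncomputable section

namespace BayesHilbert

variable {Θ : Type*} [MeasurableSpace Θ]

/-- The density `p_{η,μ} = dη/dμ` as a real-valued function (for `σ`-finite `η ≪ μ` the
Radon-Nikodym derivative is finite almost everywhere). -/
def density (η μ : Measure Θ) (θ : Θ) : ℝ :=
  (η.rnDeriv μ θ).toReal

/-- `η` belongs to `M(μ)`: it is `σ`-finite and has the same null sets as `μ`. The elements of
`B(μ)` are the classes of such measures up to a positive constant factor; we work with
representatives, and `clr` and `normSub` below depend only on the classes. -/
structure MemB (μ η : Measure Θ) : Prop where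
  sigmaFinite : SigmaFinite η
  ac : η ≪ μ
  ac' : μ ≪ η

/-- `η` belongs to the Bayes Hilbert space `B²(μ)`: it is in `B(μ)` and `log p_{η,μ} ∈ L²(μ)`. -/
structure MemB2 (μ η : Measure Θ) : Prop extends MemB μ η where
  memLp_log : MemLp (fun θ => Real.log (density η μ θ)) 2 μ

/-- The relation `=_B` between densities with respect to `ν`: equality `ν`-almost everywhere up to
a positive constant factor. -/
def EqB (ν : Measure Θ) (p q : Θ → ℝ) : Prop :=
  ∃ c : ℝ, 0 < c ∧ ∀ᵐ θ ∂ν, p θ = c * q θ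

/-- The Bayes sum `⨁ᵢ pᵢ` of finitely many densities: their pointwise product. -/
def bigOplus {ι : Type*} [Fintype ι] (p : ι → Θ → ℝ) (θ : Θ) : ℝ :=
  ∏ i, p i θ

/-- The scalar multiplication `α ⊙ p` of a density: the pointwise power. -/
def odot (α : ℝ) (p : Θ → ℝ) (θ : Θ) : ℝ :=
  p θ ^ α

/-- `f - E_μ[f]`, where `E_μ[f] = μ(Θ)⁻¹ ∫ f dμ` (just `∫ f dμ` if `μ` is a probability
measure). -/
def center (μ : Measure Θ) (f : Θ → ℝ) (θ : Θ) : ℝ :=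
  f θ - ⨍ t, f t ∂μ

/-- The centred log-ratio transform `Ψ_μ(η) = log p_{η,μ} - E_μ[log p_{η,μ}]`. -/
def clr (μ η : Measure Θ) : Θ → ℝ :=
  center μ (fun θ => Real.log (density η μ θ))

/-- `‖η - ν‖_{B²(μ)} = ‖Ψ_μ(η) - Ψ_μ(ν)‖_{L²(μ)}` for `η, ν ∈ B²(μ)`. -/
def normSub (μ η ν : Measure Θ) : ℝ :=
  (eLpNorm (clr μ η - clr μ ν) 2 μ).toReal

/-- `φ_μ(x) = log l_x - E_μ[log l_x]` is a well-defined element of `L²(μ)` for every `x`; here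
`l x` is the likelihood function `l_x` on the parameter space. -/
structure FeatureWellDefined {X : Type*} (μ : Measure Θ) (l : X → Θ → ℝ) : Prop where
  pos : ∀ x, ∀ᵐ θ ∂μ, 0 < l x θ
  integrable_log : ∀ x, Integrable (fun θ => Real.log (l x θ)) μ
  memLp : ∀ x, MemLp (center μ (fun θ => Real.log (l x θ))) 2 μ

/-- The feature map `φ_μ : X → L²(μ)`. -/
def feature {X : Type*} {μ : Measure Θ} {l : X → Θ → ℝ} (h : FeatureWellDefined μ l) (x : X) :
    Lp ℝ 2 μ :=
  (h.memLp x).toLp _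

/-- The random indices `I 0, …, I (M - 1)` are drawn uniformly without replacement from `N`
indices: each of the injections `Fin M ↪ Fin N` is drawn with the same probability. -/
def IsUniformWithoutReplacement {Ω : Type*} [MeasurableSpace Ω] (P : Measure Ω) {M N : ℕ}
    (I : Ω → (Fin M ↪ Fin N)) : Prop :=
  ∀ e : Fin M ↪ Fin N, MeasurableSet (I ⁻¹' {e}) ∧
    P.real (I ⁻¹' {e}) = 1 / (Fintype.card (Fin M ↪ Fin N) : ℝ)

end BayesHilbert

end

/-! Centred logarithms make the Bayes operations linear. The prior and the normalising constants
cancel, so the distance is the Hilbert norm of `∑ v i - (N / M) • ∑ v (e m)`, with `v` the features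
(`normSub_eq_norm`). What remains is a Hoeffding-Serfling bound for vectors.

For centred `Y`, the sum of the first `k` draws divided by `N - k` is a martingale, since the
undrawn vectors sum to minus the drawn ones. Dimension-free exponential moments come from `cosh
‖·‖`: as `cosh ∘ √` is convex, a centred increment of norm at most `b` raises the mean by at most
the factor `cosh b` (`sum_cosh_norm_add_le`). Iteration (`sum_embedding_cosh_le`), Serfling's sum
(`sum_inv_sq_le`) and Markov's inequality give the tail. Expectations are plain sums over the
equally likely embeddings. -/

namespace BayesHilbert

/-! ### Exponential moments of sampling without replacement -/

section Sampling

variable {E : Type*} [NormedAddCommGroup E] [InnerProductSpace ℝ E]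

/-- `cosh ∘ √` is convex: a squared norm below a convex combination of squares. -/
theorem cosh_le_of_sq_le {x y z p q : ℝ} (hp : 0 ≤ p) (hq : 0 ≤ q) (hpq : p + q = 1)
    (h : z ^ 2 ≤ p * x ^ 2 + q * y ^ 2) :
    Real.cosh z ≤ p * Real.cosh x + q * Real.cosh y := by
  -- The series of `cosh z` has nonnegative coefficients in `z ^ 2`, and powers are monotone and
  -- convex on the nonnegative reals.
  refine hasSum_le (fun n => ?_) (Real.hasSum_cosh z)
    (((Real.hasSum_cosh x).mul_left p).add ((Real.hasSum_cosh y).mul_left q))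
  have hconv := (convexOn_pow (𝕜 := ℝ) n).2 (sq_nonneg x) (sq_nonneg y) hp hq hpq
  simp only [smul_eq_mul] at hconv
  have hz : z ^ (2 * n) ≤ p * x ^ (2 * n) + q * y ^ (2 * n) := by
    simp only [pow_mul]
    exact (pow_le_pow_left₀ (sq_nonneg z) h n).trans hconv
  rw [← mul_div_assoc, ← mul_div_assoc, ← add_div]
  gcongr

/-- `‖f + d‖ ^ 2` is at most a convex combination of `(‖f‖ ± b) ^ 2` with weights affine in the
inner product. The correction is linear in `d`, so it vanishes when centred increments are summed.
-/
theorem cosh_norm_add_le (f d : E) {b : ℝ} (hd : ‖d‖ ≤ b) :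
    Real.cosh ‖f + d‖ ≤ Real.cosh ‖f‖ * Real.cosh b +
      inner ℝ f d * ((Real.cosh (‖f‖ + b) - Real.cosh (‖f‖ - b)) / (2 * (‖f‖ * b))) := by
  have hb : 0 ≤ b := (norm_nonneg d).trans hd
  have hin : |inner ℝ f d| ≤ ‖f‖ * b :=
    (abs_real_inner_le_norm f d).trans (by gcongr)
  -- If `‖f‖ * b = 0`, division by zero gives `t = 0`, which is harmless since the inner product is
  -- then zero.
  set t : ℝ := inner ℝ f d / (‖f‖ * b) with ht
  have ht1 : |t| ≤ 1 := by
    rw [ht, abs_div, abs_of_nonneg (by positivity : 0 ≤ ‖f‖ * b)]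
    exact div_le_one_of_le₀ hin (by positivity)
  have hmul : inner ℝ f d = t * (‖f‖ * b) := by
    rcases eq_or_ne (‖f‖ * b) 0 with h0 | h0
    · rw [h0] at hin ⊢
      simpa using hin
    · rw [ht, div_mul_cancel₀ _ h0]
  obtain ⟨h1, h2⟩ := abs_le.1 ht1
  have hsq : ‖f + d‖ ^ 2 ≤ (1 + t) / 2 * (‖f‖ + b) ^ 2 + (1 - t) / 2 * (‖f‖ - b) ^ 2 := by
    rw [norm_add_sq_real, hmul]
    have := pow_le_pow_left₀ (norm_nonneg d) hd 2
    nlinarith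
  refine (cosh_le_of_sq_le (by linarith) (by linarith) (by ring) hsq).trans (le_of_eq ?_)
  have hc : inner ℝ f d * ((Real.cosh (‖f‖ + b) - Real.cosh (‖f‖ - b)) / (2 * (‖f‖ * b))) =
      t / 2 * (Real.cosh (‖f‖ + b) - Real.cosh (‖f‖ - b)) := by
    rw [ht]; ring
  rw [hc, Real.cosh_add, Real.cosh_sub]
  ring

theorem sum_cosh_norm_add_le {ι : Type*} (s : Finset ι) (f : E) (d : ι → E) {b : ℝ}
    (hd : ∀ i ∈ s, ‖d i‖ ≤ b) (hsum : ∑ i ∈ s, d i = 0) :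
    ∑ i ∈ s, Real.cosh ‖f + d i‖ ≤ s.card * (Real.cosh ‖f‖ * Real.cosh b) := by
  refine (Finset.sum_le_sum fun i hi => cosh_norm_add_le f (d i) (hd i hi)).trans (le_of_eq ?_)
  rw [Finset.sum_add_distrib, ← Finset.sum_mul s (fun i => inner ℝ f (d i)), ← inner_sum, hsum]
  simp

/-- One more draw without replacement, after draws filling the complement of `s` with sum `S`. -/
theorem sum_cosh_draw_le {ι : Type*} (s : Finset ι) (Y : ι → E) (S : E) {D : ℝ}
    (hs : 1 < s.card) (hS : S + ∑ i ∈ s, Y i = 0) (hD : ∀ i j, ‖Y i - Y j‖ ≤ D) :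
    ∑ i ∈ s, Real.cosh ‖((s.card : ℝ) - 1)⁻¹ • (Y i + S)‖ ≤
      s.card * (Real.cosh ‖(s.card : ℝ)⁻¹ • S‖ *
        Real.exp (D ^ 2 / 2 * (((s.card : ℝ) - 1) ^ 2)⁻¹)) := by
  set n : ℝ := (s.card : ℝ) with hn
  have hn1 : 0 < n - 1 := by
    have : (1 : ℝ) < n := by rw [hn]; exact_mod_cast hs
    linarith
  have hn0 : n ≠ 0 := by linarith
  -- The martingale increment: the undrawn vectors have mean `-n⁻¹ • S`.
  set d : ι → E := fun i => (n - 1)⁻¹ • (Y i + n⁻¹ • S) with hd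
  have hsplit : ∀ i, (n - 1)⁻¹ • (Y i + S) = n⁻¹ • S + d i := by
    intro i
    have : (n - 1)⁻¹ = n⁻¹ + (n - 1)⁻¹ * n⁻¹ := by field_simp; ring
    simp only [hd]
    rw [smul_add, smul_add, smul_smul, add_left_comm, ← add_smul, ← this]
  have hsum : ∑ i ∈ s, d i = 0 := by
    rw [hd, ← Finset.smul_sum, Finset.sum_add_distrib, Finset.sum_const, ← Nat.cast_smul_eq_nsmul ℝ,
      smul_smul, ← hn, mul_inv_cancel₀ hn0, one_smul, add_comm, hS, smul_zero]
  have hbound : ∀ i ∈ s, ‖d i‖ ≤ (n - 1)⁻¹ * D := by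
    intro i _
    -- An average of differences, hence bounded by the diameter `D` itself.
    have havg : Y i + n⁻¹ • S = n⁻¹ • ∑ j ∈ s, (Y i - Y j) := by
      rw [Finset.sum_sub_distrib, Finset.sum_const, ← Nat.cast_smul_eq_nsmul ℝ, ← hn, smul_sub,
        smul_smul, inv_mul_cancel₀ hn0, one_smul, eq_neg_of_add_eq_zero_left hS, smul_neg,
        sub_eq_add_neg]
    simp only [hd]
    rw [norm_smul, Real.norm_of_nonneg (inv_nonneg.2 hn1.le), havg, norm_smul,
      Real.norm_of_nonneg (by positivity)]
    gcongr
    rw [inv_mul_le_iff₀ (by linarith), hn, ← nsmul_eq_mul]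
    exact norm_sum_le_of_le s (fun j _ => hD i j) |>.trans (by simp)
  simp_rw [hsplit]
  refine (sum_cosh_norm_add_le s _ d hbound hsum).trans ?_
  have := Real.cosh_pos ‖n⁻¹ • S‖
  gcongr
  refine (Real.cosh_le_exp_half_sq _).trans (Real.exp_le_exp.2 (le_of_eq ?_))
  rw [mul_pow, inv_pow]; ring

theorem sum_embedding_cosh_le {ι : Type*} [Fintype ι] [DecidableEq ι] (Y : ι → E)
    (hY : ∑ i, Y i = 0) {D : ℝ} (hD : ∀ i j, ‖Y i - Y j‖ ≤ D) (k : ℕ) (hk : k < Fintype.card ι) :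
    ∑ e : Fin k ↪ ι, Real.cosh ‖((Fintype.card ι : ℝ) - k)⁻¹ • ∑ m, Y (e m)‖ ≤
      Fintype.card (Fin k ↪ ι) * Real.exp (D ^ 2 / 2 *
        ∑ j ∈ Finset.range k, (((Fintype.card ι : ℝ) - (j + 1)) ^ 2)⁻¹) := by
  induction k with
  | zero => simp
  | succ k ih =>
    have hk' : k < Fintype.card ι := by omega
    set N := Fintype.card ι with hN
    have hcompl : ∀ e : Fin k ↪ ι, (Finset.univ.map e)ᶜ.card = N - k := by
      intro e
      rw [Finset.card_compl, Finset.card_map, Finset.card_univ, Fintype.card_fin]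
    have hfib : ∀ (e : Fin k ↪ ι) (F : ι → ℝ), ∑ i : {i // i ∉ Set.range e}, F i =
        ∑ i ∈ (Finset.univ.map e)ᶜ, F i := by
      intro e F
      refine (Finset.sum_subtype _ (fun i => ?_) F).symm
      simp
    have hcard : (Fintype.card (Fin (k + 1) ↪ ι) : ℝ) = (N - k : ℝ) * Fintype.card (Fin k ↪ ι) := by
      rw [Fintype.card_embedding_eq, Fintype.card_embedding_eq, Fintype.card_fin, Fintype.card_fin,
        Nat.descFactorial_succ, Nat.cast_mul, Nat.cast_sub hk'.le]
    -- Condition on the first `k` draws. The equivalence puts the new index at position `0`, which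
    -- does not affect the sum.
    rw [← (Equiv.embeddingFinSucc k ι).symm.sum_comp, Fintype.sum_sigma]
    have hstep : ∀ e : Fin k ↪ ι,
        ∑ i : {i // i ∉ Set.range e}, Real.cosh ‖((N : ℝ) - ((k + 1 : ℕ) : ℝ))⁻¹ •
          ∑ m, Y ((Equiv.embeddingFinSucc k ι).symm ⟨e, i⟩ m)‖ ≤
        (N - k : ℝ) * (Real.cosh ‖((N : ℝ) - k)⁻¹ • ∑ m, Y (e m)‖ *
          Real.exp (D ^ 2 / 2 * (((N : ℝ) - (k + 1)) ^ 2)⁻¹)) := by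
      intro e
      simp only [Equiv.coe_embeddingFinSucc_symm, Fin.sum_univ_succ, Fin.cons_zero, Fin.cons_succ]
      rw [hfib e fun i => Real.cosh ‖((N : ℝ) - ((k + 1 : ℕ) : ℝ))⁻¹ • (Y i + ∑ m, Y (e m))‖]
      have := sum_cosh_draw_le (Finset.univ.map e)ᶜ Y (∑ m, Y (e m)) (D := D)
        (by rw [hcompl]; omega)
        (by rw [← hY, ← Finset.sum_add_sum_compl (Finset.univ.map e), Finset.sum_map]) hD
      rw [hcompl, Nat.cast_sub hk'.le] at this
      simpa only [Nat.cast_add, Nat.cast_one, sub_sub] using this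
    refine (Finset.sum_le_sum fun e _ => hstep e).trans ?_
    rw [← Finset.mul_sum, ← Finset.sum_mul, hcard, Finset.sum_range_succ, mul_add, Real.exp_add,
      mul_assoc, ← mul_assoc (Fintype.card (Fin k ↪ ι) : ℝ)]
    have : (0 : ℝ) ≤ N - k := sub_nonneg.2 (by exact_mod_cast hk'.le)
    gcongr
    exact ih hk'

/-- Serfling's estimate of the sum of inverse squares. -/
theorem sum_inv_sq_le (r k : ℕ) (hr : 0 < r) :
    ∑ j ∈ Finset.range k, ((((r + k : ℕ) : ℝ) - (j + 1)) ^ 2)⁻¹ ≤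
      k * (r + 1) / ((r + k : ℕ) * (r : ℝ) ^ 2) := by
  -- After reversal the terms are `(r + j)⁻²`, independent of `k`, so induction with `r` fixed adds
  -- one term.
  rw [← Finset.sum_range_reflect]
  have h : ∀ j ∈ Finset.range k, ((((r + k : ℕ) : ℝ) - ((k - 1 - j : ℕ) + 1)) ^ 2)⁻¹ =
      (((r : ℝ) + j) ^ 2)⁻¹ := by
    intro j hj
    have hj' := Finset.mem_range.1 hj
    have h1 : k - 1 - j = k - (1 + j) := by omega
    rw [h1, Nat.cast_sub (by omega)]
    push_cast
    ring
  rw [Finset.sum_congr rfl h]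
  clear h
  have hr' : (0 : ℝ) < r := by exact_mod_cast hr
  induction k with
  | zero => simp
  | succ k ih =>
    rw [Finset.sum_range_succ]
    refine (add_le_add_left ih _).trans ?_
    push_cast
    rw [div_add' _ _ _ (by positivity), div_le_div_iff₀ (by positivity) (by positivity)]
    have hk : (0 : ℝ) ≤ k := by positivity
    have hx : (0 : ℝ) < (r : ℝ) + k := by positivity
    rw [← sub_nonneg]
    have : (k + 1) * ((r : ℝ) + 1) * ((r + k) * r ^ 2) -
        (k * (r + 1) + (((r : ℝ) + k) ^ 2)⁻¹ * ((r + k) * r ^ 2)) * ((r + (k + 1)) * r ^ 2) =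
        r ^ 2 * (r * k) / (r + k) := by
      field_simp
      ring
    rw [this]
    positivity

end Sampling

/-! ### Tail bound in a Hilbert space -/

section Tail

variable {E : Type*} [NormedAddCommGroup E] [InnerProductSpace ℝ E]
variable {ι : Type*} [Fintype ι] [DecidableEq ι]

/-- Markov's inequality for `cosh (c * ‖·‖)`; the factor `2` comes from `exp x / 2 ≤ cosh x`. -/
theorem card_filter_norm_sum_embedding_le (Y : ι → E) (hY : ∑ i, Y i = 0) {D : ℝ} (hD0 : 0 < D)
    (hD : ∀ i j, ‖Y i - Y j‖ ≤ D) (k : ℕ) (hk : k < Fintype.card ι) {Q : ℝ} (hQ0 : 0 < Q)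
    (hQ : ∑ j ∈ Finset.range k, (((Fintype.card ι : ℝ) - (j + 1)) ^ 2)⁻¹ ≤ Q)
    {u : ℝ} (hu : 0 ≤ u) :
    ((Finset.univ.filter fun e : Fin k ↪ ι =>
      u ≤ ‖((Fintype.card ι : ℝ) - k)⁻¹ • ∑ m, Y (e m)‖).card : ℝ) ≤
      2 * Real.exp (-(u ^ 2 / (2 * (D ^ 2 * Q)))) * Fintype.card (Fin k ↪ ι) := by
  -- The minimiser of `(c * D) ^ 2 / 2 * Q - c * u`.
  set c : ℝ := u / (D ^ 2 * Q) with hc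
  have hc0 : 0 ≤ c := by positivity
  have hmain := sum_embedding_cosh_le (fun i => c • Y i) (by rw [← Finset.smul_sum, hY, smul_zero])
    (D := c * D) (fun i j => by
      rw [← smul_sub, norm_smul, Real.norm_of_nonneg hc0]
      exact mul_le_mul_of_nonneg_left (hD i j) hc0) k hk
  set S := Finset.univ.filter fun e : Fin k ↪ ι =>
      u ≤ ‖((Fintype.card ι : ℝ) - k)⁻¹ • ∑ m, Y (e m)‖ with hS
  have hlow : (S.card : ℝ) * (Real.exp (c * u) / 2) ≤
      ∑ e : Fin k ↪ ι, Real.cosh ‖((Fintype.card ι : ℝ) - k)⁻¹ • ∑ m, c • Y (e m)‖ := by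
    rw [← nsmul_eq_mul]
    refine (Finset.card_nsmul_le_sum S _ _ fun e he => ?_).trans
      (Finset.sum_le_sum_of_subset_of_nonneg (Finset.subset_univ S)
        fun e _ _ => (Real.cosh_pos _).le)
    have he' := (Finset.mem_filter.1 he).2
    rw [← Finset.smul_sum, smul_comm, norm_smul, Real.norm_of_nonneg hc0, Real.cosh_eq]
    have h1 : Real.exp (c * u) ≤
        Real.exp (c * ‖((Fintype.card ι : ℝ) - k)⁻¹ • ∑ m, Y (e m)‖) := by gcongr
    have := Real.exp_pos (-(c * ‖((Fintype.card ι : ℝ) - k)⁻¹ • ∑ m, Y (e m)‖))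
    linarith
  have hup : (S.card : ℝ) * (Real.exp (c * u) / 2) ≤
      Fintype.card (Fin k ↪ ι) * Real.exp ((c * D) ^ 2 / 2 * Q) :=
    (hlow.trans hmain).trans (by gcongr)
  have h2 : c * u = u ^ 2 / (D ^ 2 * Q) := by rw [hc]; ring
  have h3 : (c * D) ^ 2 / 2 * Q = -(u ^ 2 / (2 * (D ^ 2 * Q))) + c * u := by
    rw [hc]; field_simp; ring
  rw [h3, Real.exp_add] at hup
  have hpos := Real.exp_pos (c * u)
  refine le_of_mul_le_mul_right ?_ (half_pos hpos)
  refine hup.trans (le_of_eq ?_)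
  ring

/-- Hoeffding-Serfling inequality in a Hilbert space, as a count of samples drawn without
replacement. -/
theorem card_filter_sum_sub_smul_sum_le (v : ι → E) {γ : ℝ} (hv : ∀ i, ‖v i‖ ≤ γ) {M : ℕ}
    (hM : 0 < M) (hMN : M ≤ Fintype.card ι) {δ : ℝ} (hδ : 0 < δ) (hδ' : δ < 1) :
    ((Finset.univ.filter fun e : Fin M ↪ ι =>
      √(8 * γ ^ 2 * Fintype.card ι * (Fintype.card ι - M + 1) / M) * √(2 * Real.log (2 / δ)) <
        ‖∑ i, v i - ((Fintype.card ι : ℝ) / M) • ∑ m, v (e m)‖).card : ℝ) ≤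
      δ * Fintype.card (Fin M ↪ ι) := by
  set N := Fintype.card ι with hN
  have hM' : (0 : ℝ) < M := by exact_mod_cast hM
  have hN' : (0 : ℝ) < N := by exact_mod_cast hM.trans_le hMN
  set s : ℝ := √(8 * γ ^ 2 * N * (N - M + 1) / M) * √(2 * Real.log (2 / δ)) with hs
  have hs0 : 0 ≤ s := by positivity
  have hnone : (∀ e : Fin M ↪ ι, ‖∑ i, v i - ((N : ℝ) / M) • ∑ m, v (e m)‖ ≤ s) →
      ((Finset.univ.filter fun e : Fin M ↪ ι =>
        s < ‖∑ i, v i - ((N : ℝ) / M) • ∑ m, v (e m)‖).card : ℝ) ≤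
        δ * Fintype.card (Fin M ↪ ι) := by
    intro h
    rw [Finset.filter_false_of_mem fun e _ => not_lt.2 (h e)]
    simp only [Finset.card_empty, Nat.cast_zero]
    positivity
  -- A full sample has no error; it is split off because `N - M` is inverted below.
  rcases hMN.eq_or_lt with heq | hlt
  · refine hnone fun e => ?_
    have hbij : Function.Bijective e :=
      (Fintype.bijective_iff_injective_and_card e).2 ⟨e.injective, by simpa using heq⟩
    rw [← heq, div_self hM'.ne', one_smul, hbij.sum_comp v, sub_self, norm_zero]
    exact hs0
  have hγ0 : 0 ≤ γ := by
    have : Nonempty ι := Fintype.card_pos_iff.1 (hM.trans_le hMN)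
    exact (norm_nonneg _).trans (hv (Classical.arbitrary ι))
  rcases hγ0.eq_or_lt with hγ | hγ
  · have hv0 : ∀ i, v i = 0 := fun i => norm_le_zero_iff.1 (hγ ▸ hv i)
    refine hnone fun e => ?_
    simpa [hv0] using hs0
  obtain ⟨r, hr⟩ : ∃ r, N = r + M := ⟨N - M, by omega⟩
  have hr0 : 0 < r := by omega
  have hr' : (0 : ℝ) < r := by exact_mod_cast hr0
  have hNr : (N : ℝ) = r + M := by rw [hr]; push_cast; ring
  have hNM : (N : ℝ) - M = r := by rw [hNr]; ring
  set Y : ι → E := fun i => v i - (N : ℝ)⁻¹ • ∑ j, v j with hYdef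
  have hY : ∑ i, Y i = 0 := by
    rw [hYdef, Finset.sum_sub_distrib, Finset.sum_const, Finset.card_univ,
      ← Nat.cast_smul_eq_nsmul ℝ, smul_smul, ← hN, mul_inv_cancel₀ hN'.ne', one_smul, sub_self]
  have hD : ∀ i j, ‖Y i - Y j‖ ≤ 2 * γ := by
    intro i j
    simp only [hYdef, sub_sub_sub_cancel_right]
    exact (norm_sub_le _ _).trans (by linarith [hv i, hv j])
  have hY_sum : ∀ e : Fin M ↪ ι, ‖∑ i, v i - ((N : ℝ) / M) • ∑ m, v (e m)‖ =
      N * r / M * ‖((N : ℝ) - M)⁻¹ • ∑ m, Y (e m)‖ := by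
    intro e
    have : ∑ i, v i - ((N : ℝ) / M) • ∑ m, v (e m) =
        -((N * r / M : ℝ) • ((N : ℝ) - M)⁻¹ • ∑ m, Y (e m)) := by
      rw [hYdef, Finset.sum_sub_distrib, Finset.sum_const, Finset.card_univ, Fintype.card_fin,
        ← Nat.cast_smul_eq_nsmul ℝ, hNM, smul_smul, smul_sub, smul_smul, smul_smul, neg_sub]
      have h1 : (N * r / M * (r : ℝ)⁻¹ * M * (N : ℝ)⁻¹ : ℝ) = 1 := by field_simp
      have h2 : (N * r / M * (r : ℝ)⁻¹ : ℝ) = N / M := by field_simp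
      rw [h1, h2, one_smul]
    rw [this, norm_neg, norm_smul, Real.norm_of_nonneg (by positivity)]
  set Q : ℝ := M * (r + 1) / (N * (r : ℝ) ^ 2) with hQ
  set u : ℝ := s / (N * r / M) with hu
  have hQ_le : ∑ j ∈ Finset.range M, (((N : ℝ) - (j + 1)) ^ 2)⁻¹ ≤ Q := by
    have := sum_inv_sq_le r M hr0
    rwa [← hr] at this
  have hL : 0 < Real.log (2 / δ) := Real.log_pos (by rw [lt_div_iff₀ hδ]; linarith)
  -- Twice the exponent needed; the surplus is discarded at the end of the estimate.
  have hexp : u ^ 2 / (2 * ((2 * γ) ^ 2 * Q)) = 2 * Real.log (2 / δ) := by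
    have hs2 : s ^ 2 = 8 * γ ^ 2 * N * (r + 1) / M * (2 * Real.log (2 / δ)) := by
      rw [hs, mul_pow, Real.sq_sqrt (by rw [hNM]; positivity), Real.sq_sqrt (by positivity), hNM]
    rw [hu, div_pow, hs2, hQ]
    field_simp
    ring
  have hcount := card_filter_norm_sum_embedding_le Y hY (by positivity : 0 < 2 * γ) hD M hlt
    (by positivity : 0 < Q) hQ_le (by positivity : 0 ≤ u)
  rw [hexp] at hcount
  calc ((Finset.univ.filter fun e : Fin M ↪ ι =>
        s < ‖∑ i, v i - ((N : ℝ) / M) • ∑ m, v (e m)‖).card : ℝ)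
      ≤ (Finset.univ.filter fun e : Fin M ↪ ι =>
        u ≤ ‖((N : ℝ) - M)⁻¹ • ∑ m, Y (e m)‖).card := by
        refine Nat.cast_le.2 (Finset.card_le_card fun e he => ?_)
        simp only [Finset.mem_filter, Finset.mem_univ, true_and] at he ⊢
        rw [hY_sum] at he
        rw [hu, div_le_iff₀' (by positivity)]
        exact he.le
    _ ≤ 2 * Real.exp (-(2 * Real.log (2 / δ))) * Fintype.card (Fin M ↪ ι) := hcount
    _ ≤ 2 * Real.exp (-Real.log (2 / δ)) * Fintype.card (Fin M ↪ ι) := by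
        gcongr
        linarith
    _ = δ * Fintype.card (Fin M ↪ ι) := by
        rw [Real.exp_neg, Real.exp_log (by positivity)]
        field_simp

end Tail

/-! ### From counting to probability -/

section Draw

variable {Ω : Type*} [MeasurableSpace Ω] {P : Measure Ω}

theorem IsUniformWithoutReplacement.real_preimage [IsFiniteMeasure P] {M N : ℕ}
    {I : Ω → (Fin M ↪ Fin N)} (hI : IsUniformWithoutReplacement P I)
    (A : Finset (Fin M ↪ Fin N)) :
    MeasurableSet (I ⁻¹' A) ∧ P.real (I ⁻¹' A) = A.card / Fintype.card (Fin M ↪ Fin N) := by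
  have hA : I ⁻¹' (A : Set (Fin M ↪ Fin N)) = ⋃ e ∈ A, I ⁻¹' {e} := by
    ext ω; simp
  rw [hA]
  refine ⟨Finset.measurableSet_biUnion A fun e _ => (hI e).1, ?_⟩
  rw [measureReal_biUnion_finset
    (fun e _ e' _ hne => Disjoint.preimage I (Set.disjoint_singleton.2 hne))
    fun e _ => (hI e).1, Finset.sum_congr rfl fun e _ => (hI e).2, Finset.sum_const, nsmul_eq_mul,
    mul_one_div]

end Draw

/-! ### Linearisation by the centred log-ratio -/

section Clr

variable {Θ : Type*} [MeasurableSpace Θ] {μ : Measure Θ}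

theorem center_congr_ae {f g : Θ → ℝ} (h : f =ᵐ[μ] g) : center μ f =ᵐ[μ] center μ g := by
  filter_upwards [h] with θ hθ
  rw [center, center, hθ, average_congr h]

theorem center_const_add_mul_sum_add [IsFiniteMeasure μ] {ι : Type*} [Fintype ι] (C w : ℝ)
    {L : ι → Θ → ℝ} {g : Θ → ℝ} (hL : ∀ i, Integrable (L i) μ) (hg : Integrable g μ) :
    center μ (fun θ => C + w * ∑ i, L i θ + g θ) =ᵐ[μ]
      fun θ => w * ∑ i, center μ (L i) θ + center μ g θ := by
  rcases eq_or_ne μ 0 with rfl | hμ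
  · simp [Filter.EventuallyEq]
  have hμ' : μ.real Set.univ ≠ 0 := by
    rw [measureReal_def]
    exact (ENNReal.toReal_pos (Measure.measure_univ_ne_zero.2 hμ) (measure_ne_top _ _)).ne'
  have hsum : Integrable (fun θ => ∑ i, L i θ) μ := integrable_finsetSum _ fun i _ => hL i
  refine Filter.Eventually.of_forall fun θ => ?_
  simp only [center, average_eq, smul_eq_mul]
  have hadd : ∫ t, (C + w * ∑ i, L i t + g t) ∂μ =
      ∫ t, (C + w * ∑ i, L i t) ∂μ + ∫ t, g t ∂μ :=
    integral_add ((integrable_const C).add (hsum.const_mul w)) hg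
  rw [hadd, integral_add (integrable_const C) (hsum.const_mul w), integral_const, integral_const_mul,
    integral_finsetSum _ fun i _ => hL i, Finset.sum_sub_distrib, ← Finset.mul_sum, smul_eq_mul]
  field_simp
  ring

/-- The chain rule for Radon-Nikodym derivatives. The unknown normalising factor becomes an additive
constant, which centring removes. -/
theorem log_density_ae_eq [SigmaFinite μ] {ι : Type*} [Fintype ι] {l : ι → Θ → ℝ}
    (hl : ∀ i, ∀ᵐ θ ∂μ, 0 < l i θ) {ν η : Measure Θ} (hν : MemB μ ν) (hη : MemB μ η) {w : ℝ}
    (h : EqB ν (density η ν) (odot w (bigOplus l))) :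
    ∃ C : ℝ, (fun θ => Real.log (density η μ θ)) =ᵐ[μ]
      fun θ => C + w * ∑ i, Real.log (l i θ) + Real.log (density ν μ θ) := by
  have := hν.sigmaFinite
  have := hη.sigmaFinite
  obtain ⟨c, hc, hcη⟩ := h
  refine ⟨Real.log c, ?_⟩
  filter_upwards [ae_all_iff.2 hl, hν.ac'.ae_le hcη,
    Measure.rnDeriv_mul_rnDeriv (κ := μ) (hη.ac.trans hν.ac'), Measure.rnDeriv_pos' hν.ac',
    Measure.rnDeriv_lt_top ν μ] with θ hlθ hcθ hchain hpos htop
  have hprod : 0 < ∏ i, l i θ := Finset.prod_pos fun i _ => hlθ i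
  have hνpos : 0 < density ν μ θ := ENNReal.toReal_pos hpos.ne' htop.ne
  have hmul : density η μ θ = density η ν θ * density ν μ θ := by
    simp only [density]
    rw [← hchain, Pi.mul_apply, ENNReal.toReal_mul]
  rw [hmul, hcθ, odot, bigOplus, Real.log_mul (by positivity) hνpos.ne',
    Real.log_mul hc.ne' (by positivity), Real.log_rpow hprod,
    Real.log_prod fun i _ => (hlθ i).ne']

variable {X : Type*} {l : X → Θ → ℝ}

theorem FeatureWellDefined.memLp_log [IsFiniteMeasure μ] (hl : FeatureWellDefined μ l) (x : X) :
    MemLp (fun θ => Real.log (l x θ)) 2 μ := by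
  have := (hl.memLp x).add (memLp_const (⨍ t, Real.log (l x t) ∂μ))
  refine this.ae_eq (Filter.Eventually.of_forall fun θ => ?_)
  simp [center]

variable [IsFiniteMeasure μ] {ι : Type*} [Fintype ι] {x : ι → X}
  {ν η : Measure Θ} {w : ℝ}

theorem memB2_of_eqB (hl : FeatureWellDefined μ l) (hν : MemB2 μ ν) (hη : MemB μ η)
    (h : EqB ν (density η ν) (odot w (bigOplus fun i => l (x i)))) : MemB2 μ η := by
  obtain ⟨C, hC⟩ := log_density_ae_eq (fun i => hl.pos (x i)) hν.toMemB hη h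
  refine ⟨hη, MemLp.ae_eq hC.symm ?_⟩
  exact ((memLp_const C).add ((memLp_finsetSum _ fun i _ => hl.memLp_log (x i)).const_mul w)).add
    hν.memLp_log

theorem clr_ae_eq (hl : FeatureWellDefined μ l) (hν : MemB2 μ ν) (hη : MemB μ η)
    (h : EqB ν (density η ν) (odot w (bigOplus fun i => l (x i)))) :
    clr μ η =ᵐ[μ] ⇑(w • ∑ i, feature hl (x i)) + clr μ ν := by
  obtain ⟨C, hC⟩ := log_density_ae_eq (fun i => hl.pos (x i)) hν.toMemB hη h
  have h1 := (center_congr_ae hC).trans (center_const_add_mul_sum_add C w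
    (fun i => hl.integrable_log (x i)) (hν.memLp_log.integrable one_le_two))
  filter_upwards [h1, Lp.coeFn_smul w (∑ i, feature hl (x i)),
    Lp.coeFn_finsetSum Finset.univ fun i => feature hl (x i),
    ae_all_iff.2 fun i => (hl.memLp (x i)).coeFn_toLp] with θ h1 h2 h3 h4
  rw [clr, h1, Pi.add_apply, h2, Pi.smul_apply, h3, Finset.sum_apply, smul_eq_mul, clr]
  simp only [feature, h4]

/-- Both transforms contain the same summand `clr μ ν`, which cancels in the difference. -/
theorem normSub_eq_norm {ι' : Type*} [Fintype ι'] {x' : ι' → X} {η' : Measure Θ} {w' : ℝ}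
    (hl : FeatureWellDefined μ l) (hν : MemB2 μ ν) (hη : MemB μ η) (hη' : MemB μ η')
    (h : EqB ν (density η ν) (odot w (bigOplus fun i => l (x i))))
    (h' : EqB ν (density η' ν) (odot w' (bigOplus fun i => l (x' i)))) :
    normSub μ η η' = ‖w • ∑ i, feature hl (x i) - w' • ∑ i, feature hl (x' i)‖ := by
  rw [normSub, Lp.norm_def]
  congr 1
  refine eLpNorm_congr_ae ?_
  filter_upwards [clr_ae_eq hl hν hη h, clr_ae_eq hl hν hη' h',
    Lp.coeFn_sub (w • ∑ i, feature hl (x i)) (w' • ∑ i, feature hl (x' i))] with θ h1 h2 h3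
  rw [Pi.sub_apply, h1, h2, h3]
  simp

end Clr

end BayesHilbert

/-! ### The posterior approximation bound -/

theorem corollary5p1
    {Θ X Ω : Type*} [MeasurableSpace Θ] [MetricSpace X] [MeasurableSpace X] [BorelSpace X]
    [MeasurableSpace Ω]
    (μ : Measure Θ) [IsFiniteMeasure μ]
    (l : X → Θ → ℝ) (hl : BayesHilbert.FeatureWellDefined μ l)
    (hφ : @Measurable X (Lp ℝ 2 μ) _ (borel _) (BayesHilbert.feature hl))
    (N M : ℕ) (hM : 0 < M) (hMN : M ≤ N) (x : Fin N → X)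
    (π₀ π : Measure Θ) (hπ₀ : BayesHilbert.MemB2 μ π₀) (hπ : BayesHilbert.MemB2 μ π)
    (hpost : BayesHilbert.EqB π₀ (BayesHilbert.density π π₀)
      (BayesHilbert.bigOplus fun n => l (x n)))
    (P : Measure Ω) [IsProbabilityMeasure P]
    (I : Ω → (Fin M ↪ Fin N)) (hI : BayesHilbert.IsUniformWithoutReplacement P I)
    (πM : Ω → Measure Θ) (hπM : ∀ ω, BayesHilbert.MemB μ (πM ω))
    (hpostM : ∀ ω, BayesHilbert.EqB π₀ (BayesHilbert.density (πM ω) π₀)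
      (BayesHilbert.odot ((N : ℝ) / M) (BayesHilbert.bigOplus fun m => l (x (I ω m)))))
    (γ : ℝ) (hγ : ∀ n, ‖BayesHilbert.feature hl (x n)‖ ≤ γ)
    (δ : ℝ) (hδ : 0 < δ) (hδ' : δ < 1) :
    (∀ ω, BayesHilbert.MemB2 μ (πM ω)) ∧
      1 - δ ≤ P.real {ω | BayesHilbert.normSub μ π (πM ω) ≤
        √(8 * γ ^ 2 * N * (N - M + 1) / M) * √(2 * Real.log (2 / δ))} := by
  refine ⟨fun ω => BayesHilbert.memB2_of_eqB hl hπ₀ (hπM ω) (hpostM ω), ?_⟩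
  -- Weight `1` gives the exact posterior the same form as the subsampled one.
  have hpost1 : BayesHilbert.EqB π₀ (BayesHilbert.density π π₀)
      (BayesHilbert.odot 1 (BayesHilbert.bigOplus fun n => l (x n))) := by
    simpa [BayesHilbert.EqB, BayesHilbert.odot] using hpost
  have hcard := BayesHilbert.card_filter_sum_sub_smul_sum_le
    (fun n => BayesHilbert.feature hl (x n)) hγ hM (by simpa using hMN) hδ hδ'
  simp only [Fintype.card_fin] at hcard
  set s : ℝ := √(8 * γ ^ 2 * N * (N - M + 1) / M) * √(2 * Real.log (2 / δ))
  set A := Finset.univ.filter fun e : Fin M ↪ Fin N =>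
    s < ‖∑ n, BayesHilbert.feature hl (x n) -
      ((N : ℝ) / M) • ∑ m, BayesHilbert.feature hl (x (e m))‖ with hA
  have hset : {ω | BayesHilbert.normSub μ π (πM ω) ≤ s} = (I ⁻¹' A)ᶜ := by
    ext ω
    rw [Set.mem_ofPred_eq, BayesHilbert.normSub_eq_norm hl hπ₀ hπ.toMemB (hπM ω) hpost1 (hpostM ω)]
    simp [hA]
  obtain ⟨hmeas, hreal⟩ := hI.real_preimage A
  have hpos : (0 : ℝ) < Fintype.card (Fin M ↪ Fin N) := by
    have : Nonempty (Fin M ↪ Fin N) := ⟨Fin.castLEEmb hMN⟩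
    exact_mod_cast Fintype.card_pos
  rw [hset, probReal_compl_eq_one_sub hmeas, hreal]
  have := (div_le_iff₀ hpos).2 hcard
  linarith
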